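/- Write $\mathrm{FIN}$ for the set of nonempty finite subsets of $\omega$. A block sequence is a sequence $X=(x_n)_{n<\omega}$ in $\mathrm{FIN}$ with $\max(x_n)<\min(x_{n+1})$ for all $n$, and $[X]$ is the set of all unions of finitely many (at least one) terms of $X$. An ultrafilter $\mathcal U$ on $\mathrm{FIN}$ is idempotent if for every $A\subseteq\mathrm{FIN}$: $A\in\mathcal U$ if and only if $\{x:\{y:\max(x)<\min(y)\text{ and }x\cup y\in A\}\in\mathcal U\}\in\mathcal U$. It is block-generated if it is idempotent and every $A\in\mathcal U$ contains some $[X]\in\mathcal U$ with $X$ a block sequence. Block sequences $X_n=(x^n_k)_{k<\omega}$ converge to $X=(x_k)_{k<\omega}$ if for every $l$ there is $m$ such that $x^n_k=x_k$ for all $n\ge m$ and $k\le l$. A block-generated $\mathcal U$ is block-basic if, whenever all $[X_n]\in\mathcal U$ and $X_n\to X$ with $[X]\in\mathcal U$, there are $n_0<n_1<\cdots$ with $\bigcap_{k<\omega}[X_{n_k}]\in\mathcal U$. Let $\mathcal U_{\min}$, $\mathcal U_{\max}$ (on $\omega$) and $\mathcal U_{\min,\max}$ (on $\omega\times\omega$)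 be the images of $\mathcal U$ under $x\mapsto\min(x)$, $x\mapsto\max(x)$ and $x\mapsto(\min(x),\max(x))$. For partially ordered sets $D,E$, write $D\le_T E$ if there is a map $E\to D$ sending every cofinal subset of $E$ to a cofinal subset of $D$, and $D<_T E$ if $D\le_T E$ and $E\not\le_T D$; ultrafilters are ordered by reverse inclusion $\supseteq$, and $\mathbf 1$ is the one-point order. An ultrafilter $\mathcal V$ on $\omega$ is selective if every $f:\omega\to\omega$ is constant or one-to-one on some member of $\mathcal V$. **Theorem.** Assume the Continuum Hypothesis. Then there is a block-basic ultrafilter $\mathcal U$ on $\mathrm{FIN}$ such that $\mathcal U_{\min,\max}<_T\mathcal U$, the ultrafilters $\mathcal U_{\min}$ and $\mathcal U_{\max}$ are selective and Tukey incomparable (neither $\mathcal U_{\min}\le_T\mathcal U_{\max}$ nor $\mathcal U_{\max}\le_T\mathcal U_{\min}$), and moreover $$\mathbf 1<_T\mathcal U_{\min}<_T\mathcal U_{\min,\max}\quad\text{and}\quad \mathbf 1<_T\mathcal U_{\max}<_T\mathcal U_{\min,\max}.$$ -/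

import Mathlib

/-! ### Tukey reducibility -/

/-- `D` is Tukey reducible to `E`: there is a cofinal map from `E` to `D`, that is, a map sending
every cofinal subset of `E` to a cofinal subset of `D`. -/
def TukeyLE (D E : Type*) [Preorder D] [Preorder E] : Prop :=
  ∃ f : E → D, ∀ C : Set E, IsCofinal C → IsCofinal (f '' C)

/-- Strict Tukey reducibility. -/
def TukeyLT (D E : Type*) [Preorder D] [Preorder E] : Prop :=
  TukeyLE D E ∧ ¬ TukeyLE E D

/-- Neither order is Tukey reducible to the other. -/
def TukeyIncomparable (D E : Type*) [Preorder D] [Preorder E] : Prop :=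
  ¬ TukeyLE D E ∧ ¬ TukeyLE E D

/-- The members of an ultrafilter, ordered by reverse inclusion: `X ≤ Y` iff `X ⊇ Y`. -/
abbrev UltrafilterOrder {α : Type*} (U : Ultrafilter α) : Type _ :=
  {s : Set α // s ∈ U}ᵒᵈ

/-- An ultrafilter on `ℕ` is selective if every function is constant or one-to-one on one of
its members. -/
def IsSelective (V : Ultrafilter ℕ) : Prop :=
  ∀ f : ℕ → ℕ, ∃ X ∈ V, (∃ c, ∀ n ∈ X, f n = c) ∨ Set.InjOn f X

/-! ### Nonempty finite sets of natural numbers and their block sequences -/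

/-- The set of nonempty finite subsets of `ℕ`. -/
abbrev FIN : Type := {s : Finset ℕ // s.Nonempty}

namespace FIN

/-- The least element. -/
def min (x : FIN) : ℕ := x.1.min' x.2

/-- The largest element. -/
def max (x : FIN) : ℕ := x.1.max' x.2

/-- The pair formed by the least and the largest element. -/
def minMax (x : FIN) : ℕ × ℕ := (x.min, x.max)

/-- The union of two elements (used when `x.max < y.min`). -/
def union (x y : FIN) : FIN := ⟨x.1 ∪ y.1, x.2.mono Finset.subset_union_left⟩

end FIN

/-- `U` is idempotent for the partial semigroup operation on `FIN`, where `x ∪ y` is defined only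
if `max x < min y`: a set `A` is in `U` iff for `U`-many `x`, for `U`-many `y`, the union `x ∪ y`
is defined and lies in `A`. -/
def IsIdempotentUltrafilter (U : Ultrafilter FIN) : Prop :=
  ∀ A : Set FIN, A ∈ U ↔ {x : FIN | {y : FIN | x.max < y.min ∧ x.union y ∈ A} ∈ U} ∈ U

/-- Infinite block sequences of elements of `FIN`. -/
def BlockSeq : Type := {X : ℕ → FIN // ∀ n, (X n).max < (X (n + 1)).min}

/-- `X.span` is `[X]`, the set of unions of finitely many (at least one) terms of `X`. -/
def BlockSeq.span (X : BlockSeq) : Set FIN :=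
  {y | ∃ I : Finset ℕ, I.Nonempty ∧ y.1 = I.biUnion fun n => (X.1 n).1}

/-- The sequence `X 0, X 1, …` of block sequences converges to `Y`: on every initial segment of
indices, all but finitely many `X n` agree with `Y`. -/
def BlockSeq.ConvergesTo (X : ℕ → BlockSeq) (Y : BlockSeq) : Prop :=
  ∀ l : ℕ, ∃ m : ℕ, ∀ n ≥ m, ∀ k ≤ l, (X n).1 k = Y.1 k

/-- An idempotent ultrafilter on `FIN` with a base of sets of the form `[X]`. -/
def IsBlockGenerated (U : Ultrafilter FIN) : Prop :=
  IsIdempotentUltrafilter U ∧ ∀ A ∈ U, ∃ X : BlockSeq, X.span ∈ U ∧ X.span ⊆ A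

/-- A block-generated ultrafilter such that every convergent sequence of block sequences `X n`,
with all `[X n]` and the `[Y]` of the limit `Y` in the ultrafilter, has a subsequence whose
spans `[X (φ k)]` have their intersection in the ultrafilter. -/
def IsBlockBasic (U : Ultrafilter FIN) : Prop :=
  IsBlockGenerated U ∧
    ∀ (X : ℕ → BlockSeq) (Y : BlockSeq), (∀ n, (X n).span ∈ U) → Y.span ∈ U →
      BlockSeq.ConvergesTo X Y →
      ∃ φ : ℕ → ℕ, StrictMono φ ∧ (⋂ k, (X (φ k)).span) ∈ U

/-! Order block sequences by inclusion of spans. The ultrafilter is built generically: under CH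
there are only `ℵ₁` requirements, each dense in this order, and countable almost decreasing families
have lower bounds, so a tower of length `ω₁` meets all of them.

The requirements `Decides` are dense by Hindman's theorem in its idempotent-ultrafilter form. They
make `U` stable, and stability yields that `U` is block-basic and that its min and max images are
selective.

The requirements `Defeats` rule out Tukey reductions. A reduction may be taken monotone, and
stability makes a monotone map recoverable on a base from countably many values
(`IsStable.exists_approx`). A candidate reduction is thus a single sequence `q`, and there are
continuum many. Each is killed below any block sequence (`Splits.exists_defeats`): two block
sequences with equal `π`-values and disjoint sets of `ρ`-values look alike to `q` but need different
answers. This is applied to (min, max), (max, min) and (minMax, identity); the remaining relations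
come from projections and transitivity. -/

namespace FIN

theorem min_mem (x : FIN) : x.min ∈ x.1 := Finset.min'_mem _ _

theorem max_mem (x : FIN) : x.max ∈ x.1 := Finset.max'_mem _ _

theorem min_le (x : FIN) {n : ℕ} (h : n ∈ x.1) : x.min ≤ n := Finset.min'_le _ _ h

theorem le_max (x : FIN) {n : ℕ} (h : n ∈ x.1) : n ≤ x.max := Finset.le_max' _ _ h

theorem min_le_max (x : FIN) : x.min ≤ x.max := x.min_le x.max_mem

theorem min_eq {x : FIN} {n : ℕ} (h : n ∈ x.1) (h' : ∀ m ∈ x.1, n ≤ m) : x.min = n :=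
  le_antisymm (x.min_le h) (h' _ x.min_mem)

theorem max_eq {x : FIN} {n : ℕ} (h : n ∈ x.1) (h' : ∀ m ∈ x.1, m ≤ n) : x.max = n :=
  le_antisymm (h' _ x.max_mem) (x.le_max h)

theorem union_assoc (x y z : FIN) : (x.union y).union z = x.union (y.union z) :=
  Subtype.ext (Finset.union_assoc _ _ _)

/-- The singleton `{n}`. -/
def single (n : ℕ) : FIN := ⟨{n}, Finset.singleton_nonempty n⟩

theorem finite_max_le (n : ℕ) : {x : FIN | x.max ≤ n}.Finite := by
  refine Set.Finite.of_finite_image (f := Subtype.val)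
    (((Finset.range (n + 1)).powerset.finite_toSet).subset ?_) Subtype.val_injective.injOn
  rintro _ ⟨x, hx, rfl⟩
  simp only [Finset.coe_powerset, Set.mem_preimage, Set.mem_powerset_iff]
  intro m hm
  simpa using Nat.lt_succ_of_le ((x.le_max hm).trans hx)

end FIN

namespace BlockSeq

variable (X : BlockSeq)

theorem max_lt_min {i j : ℕ} (h : i < j) : (X.1 i).max < (X.1 j).min := by
  induction j, h using Nat.le_induction with
  | base => exact X.2 i
  | succ j _ ih => exact ih.trans_le ((X.1 j).min_le_max.trans (X.2 j).le)

theorem strictMono_max : StrictMono fun i => (X.1 i).max := fun _ j h =>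
  (X.max_lt_min h).trans_le (X.1 j).min_le_max

theorem strictMono_min : StrictMono fun i => (X.1 i).min := fun i _ h =>
  (X.1 i).min_le_max.trans_lt (X.max_lt_min h)

theorem le_max (i : ℕ) : i ≤ (X.1 i).max := X.strictMono_max.le_apply

theorem le_min (i : ℕ) : i ≤ (X.1 i).min := X.strictMono_min.le_apply

/-- The union of the terms of `X` with index in `I`. -/
def app (I : FIN) : FIN :=
  ⟨I.1.biUnion fun n => (X.1 n).1, by
    obtain ⟨i, hi⟩ := I.2
    exact Finset.Nonempty.mono (Finset.subset_biUnion_of_mem (fun n => (X.1 n).1) hi) (X.1 i).2⟩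

theorem mem_app {I : FIN} {m : ℕ} : m ∈ (X.app I).1 ↔ ∃ i ∈ I.1, m ∈ (X.1 i).1 :=
  Finset.mem_biUnion

theorem mem_span {y : FIN} : y ∈ X.span ↔ ∃ I : FIN, X.app I = y :=
  ⟨fun ⟨I, hI, h⟩ => ⟨⟨I, hI⟩, Subtype.ext h.symm⟩, fun ⟨I, h⟩ => ⟨I.1, I.2, h ▸ rfl⟩⟩

theorem app_mem_span (I : FIN) : X.app I ∈ X.span := X.mem_span.2 ⟨I, rfl⟩

theorem app_single (n : ℕ) : X.app (FIN.single n) = X.1 n :=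
  Subtype.ext Finset.singleton_biUnion

theorem apply_mem_span (n : ℕ) : X.1 n ∈ X.span := X.mem_span.2 ⟨_, X.app_single n⟩

theorem app_union (I J : FIN) : X.app (I.union J) = (X.app I).union (X.app J) :=
  Subtype.ext (Finset.union_biUnion ..)

theorem union_mem_span {x y : FIN} (hx : x ∈ X.span) (hy : y ∈ X.span) : x.union y ∈ X.span := by
  obtain ⟨I, rfl⟩ := X.mem_span.1 hx
  obtain ⟨J, rfl⟩ := X.mem_span.1 hy
  exact X.mem_span.2 ⟨_, X.app_union I J⟩

theorem min_app (I : FIN) : (X.app I).min = (X.1 I.min).min := by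
  refine FIN.min_eq (X.mem_app.2 ⟨_, I.min_mem, FIN.min_mem _⟩) fun m hm => ?_
  obtain ⟨i, hi, h⟩ := X.mem_app.1 hm
  exact (X.strictMono_min.monotone (I.min_le hi)).trans (FIN.min_le _ h)

theorem max_app (I : FIN) : (X.app I).max = (X.1 I.max).max := by
  refine FIN.max_eq (X.mem_app.2 ⟨_, I.max_mem, FIN.max_mem _⟩) fun m hm => ?_
  obtain ⟨i, hi, h⟩ := X.mem_app.1 hm
  exact (FIN.le_max _ h).trans (X.strictMono_max.monotone (I.le_max hi))

/-- The sequence without its first `n` terms. -/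
def tail (n : ℕ) : BlockSeq :=
  ⟨fun k => X.1 (n + k), fun k => X.max_lt_min (by omega)⟩

/-- A set closed under unions that contains all terms of a block sequence contains its span. -/
theorem span_subset_of_closed {S : Set FIN} (hS : ∀ x ∈ S, ∀ y ∈ S, x.union y ∈ S)
    (h : ∀ n, X.1 n ∈ S) : X.span ⊆ S := by
  intro y hy
  obtain ⟨⟨I, hI⟩, rfl⟩ := X.mem_span.1 hy
  induction hI using Finset.Nonempty.cons_induction with
  | singleton a => exact (X.app_single a).symm ▸ h a
  | cons a s ha hs ih =>
    have : X.app ⟨Finset.cons a s ha, Finset.cons_nonempty ha⟩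
        = (X.app (FIN.single a)).union (X.app ⟨s, hs⟩) := by
      rw [← app_union]
      congr 1
      exact Subtype.ext (Finset.cons_eq_insert a s ha)
    rw [this, app_single]
    exact hS _ (h a) _ (ih (X.app_mem_span _))

theorem span_subset_span {X Y : BlockSeq} (h : ∀ n, X.1 n ∈ Y.span) : X.span ⊆ Y.span :=
  X.span_subset_of_closed (fun _ hx _ hy => Y.union_mem_span hx hy) h

theorem tail_span_subset (n : ℕ) : (X.tail n).span ⊆ X.span :=
  span_subset_span fun _ => X.apply_mem_span _

theorem tail_span_anti {m n : ℕ} (h : m ≤ n) : (X.tail n).span ⊆ (X.tail m).span :=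
  span_subset_span fun k => by
    have : (X.tail n).1 k = (X.tail m).1 (n - m + k) := congrArg X.1 (by omega)
    exact this ▸ apply_mem_span _ _

theorem mem_tail_span {n : ℕ} {y : FIN} (hy : y ∈ X.span) (h : ∀ i < n, (X.1 i).min < y.min) :
    y ∈ (X.tail n).span := by
  obtain ⟨I, rfl⟩ := X.mem_span.1 hy
  have hI : ∀ i ∈ I.1, n ≤ i := fun i hi => by
    by_contra! hlt
    have := h i hlt
    rw [min_app] at this
    exact (this.trans_le (X.strictMono_min.monotone (I.min_le hi))).false
  refine (mem_span _).2 ⟨⟨I.1.image (· - n), I.2.image _⟩, ?_⟩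
  ext m
  simp only [mem_app, Finset.mem_image, exists_exists_and_eq_and]
  refine exists_congr fun i => and_congr_right fun hi => ?_
  have : (X.tail n).1 (i - n) = X.1 i := congrArg X.1 (by have := hI i hi; omega)
  rw [this]

theorem lt_min_of_mem_tail_span {n : ℕ} {y : FIN} (hy : y ∈ (X.tail (n + 1)).span) :
    (X.1 n).max < y.min := by
  obtain ⟨I, rfl⟩ := (mem_span _).1 hy
  rw [min_app]
  exact X.max_lt_min (by omega)

theorem mem_tail_span_of_lt {n : ℕ} {y : FIN} (hy : y ∈ X.span) (h : (X.1 n).max < y.min) :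
    y ∈ (X.tail (n + 1)).span :=
  X.mem_tail_span hy fun i hi => ((X.1 i).min_le_max.trans
    (X.strictMono_max.monotone (Nat.le_of_lt_succ hi))).trans_lt h

/-- The block sequence of unions of terms of `X` along a block sequence of index sets. -/
def comp (J : BlockSeq) : BlockSeq :=
  ⟨fun n => X.app (J.1 n), fun n => by rw [max_app, min_app]; exact X.max_lt_min (J.2 n)⟩

theorem comp_span_subset (J : BlockSeq) : (X.comp J).span ⊆ X.span :=
  span_subset_span fun _ => X.app_mem_span _

theorem comp_app (J : BlockSeq) (I : FIN) : (X.comp J).app I = X.app (J.app I) := by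
  ext m
  constructor
  · intro h
    obtain ⟨i, hi, h⟩ := (mem_app _).1 h
    obtain ⟨j, hj, h⟩ := (mem_app _).1 h
    exact (mem_app _).2 ⟨j, (mem_app _).2 ⟨i, hi, hj⟩, h⟩
  · intro h
    obtain ⟨j, hj, h⟩ := (mem_app _).1 h
    obtain ⟨i, hi, hj⟩ := (mem_app _).1 hj
    exact (mem_app _).2 ⟨i, hi, (mem_app _).2 ⟨j, hj, h⟩⟩

theorem exists_comp {X Z : BlockSeq} (h : Z.span ⊆ X.span) : ∃ J, X.comp J = Z := by
  choose J hJ using fun n => X.mem_span.1 (h (Z.apply_mem_span n))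
  refine ⟨⟨J, fun n => ?_⟩, Subtype.ext (funext hJ)⟩
  have := Z.2 n
  rw [← hJ, ← hJ, max_app, min_app] at this
  by_contra! hle
  exact (this.trans_le ((X.strictMono_min.monotone hle).trans (FIN.min_le_max _))).false

theorem eq_of_mem {i j m : ℕ} (hi : m ∈ (X.1 i).1) (hj : m ∈ (X.1 j).1) : i = j := by
  have h : ∀ {i j}, i < j → m ∈ (X.1 i).1 → m ∉ (X.1 j).1 := fun h hi hj =>
    (((X.1 _).le_max hi).trans_lt (X.max_lt_min h)).not_ge ((X.1 _).min_le hj)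
  by_contra hne
  rcases lt_or_gt_of_ne hne with h' | h'
  exacts [h h' hi hj, h h' hj hi]

theorem app_injective : Function.Injective X.app := by
  have h : ∀ {I J : FIN}, X.app I = X.app J → ∀ i ∈ I.1, i ∈ J.1 := fun {I J} h i hi => by
    have : (X.1 i).min ∈ (X.app J).1 := h ▸ X.mem_app.2 ⟨i, hi, FIN.min_mem _⟩
    obtain ⟨j, hj, h⟩ := X.mem_app.1 this
    rwa [X.eq_of_mem (FIN.min_mem _) h]
  exact fun I J e => Subtype.ext (Finset.ext fun i => ⟨h e i, h e.symm i⟩)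

theorem span_eq_range : X.span = Set.range X.app := Set.ext fun _ => X.mem_span

end BlockSeq

/-! ### Idempotent ultrafilters and Hindman-type diagonalization -/

section Hindman

/-- `FIN` as a semigroup under union. -/
abbrev FIN.semigroup : Semigroup FIN where
  mul := FIN.union
  mul_assoc := FIN.union_assoc

attribute [local instance] FIN.semigroup Ultrafilter.mul Ultrafilter.semigroup

/-- Ellis's lemma on the compact subsemigroup of ultrafilters containing every tail span of `X`. -/
theorem BlockSeq.exists_idempotent (X : BlockSeq) :
    ∃ V : Ultrafilter FIN, (∀ n, (X.tail n).span ∈ V) ∧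
      ∀ A ∈ V, {x : FIN | {y : FIN | x.union y ∈ A} ∈ V} ∈ V := by
  let S : Set (Ultrafilter FIN) := ⋂ n, {V | (X.tail n).span ∈ V}
  have hne : S.Nonempty := by
    have hf : (Filter.map X.1 Filter.atTop).NeBot := inferInstance
    refine ⟨Ultrafilter.of (Filter.map X.1 Filter.atTop), Set.mem_iInter.2 fun n => ?_⟩
    refine Ultrafilter.of_le _ ?_
    refine Filter.mem_map.2 ?_
    filter_upwards [Filter.mem_atTop n] with k hk
    have : (X.tail n).1 (k - n) = X.1 k := congrArg X.1 (Nat.add_sub_cancel' hk)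
    exact Set.mem_preimage.2 (this ▸ (X.tail n).apply_mem_span _)
  have hc : IsCompact S :=
    (isClosed_iInter fun n => ultrafilter_isClosed_basic _).isCompact
  obtain ⟨V, hV, hVV⟩ := exists_idempotent_in_compact_subsemigroup
    (Ultrafilter.continuous_mul_left (M := FIN)) S hne hc (by
      intro U hU V hV
      simp only [S, Set.mem_iInter, Set.mem_ofPred_eq] at hU hV ⊢
      intro n
      refine (Ultrafilter.eventually_mul U V (· ∈ (X.tail n).span)).2 ?_
      filter_upwards [hU n] with x hx
      filter_upwards [hV n] with y hy
      exact union_mem_span _ hx hy)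
  refine ⟨V, fun n => Set.mem_iInter.1 hV n, fun A hA => ?_⟩
  exact (Ultrafilter.eventually_mul V V (· ∈ A)).1 (by rw [hVV]; exact hA)

end Hindman

/-- A block sequence diagonalizing a sequence of members of an idempotent ultrafilter. -/
theorem BlockSeq.exists_diagonal {V : Ultrafilter FIN}
    (hV : ∀ A ∈ V, {x : FIN | {y : FIN | x.union y ∈ A} ∈ V} ∈ V)
    (hmin : ∀ n, {x : FIN | n < x.min} ∈ V) {A : ℕ → Set FIN} (hA : ∀ n, A n ∈ V) :
    ∃ Y : BlockSeq, Y.span ⊆ A 0 ∧ ∀ i, (Y.tail (i + 1)).span ⊆ A (Y.1 i).max := by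
  have hpick : ∀ B : {B // B ∈ V}, ∃ x ∈ B.1, {y : FIN | x.union y ∈ B.1} ∈ V := fun B =>
    V.nonempty_of_mem (Filter.inter_mem B.2 (hV _ B.2))
  choose pick pick_mem pick_large using hpick
  -- Galvin–Glazer step: keep only those `y` whose union with the chosen element stays in `B`.
  let next (B : {B // B ∈ V}) : {B // B ∈ V} :=
    ⟨B.1 ∩ {y | (pick B).union y ∈ B.1} ∩ {y | (pick B).max < y.min} ∩ A (pick B).max,
      Filter.inter_mem (Filter.inter_mem (Filter.inter_mem B.2 (pick_large B)) (hmin _)) (hA _)⟩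
  let B (n : ℕ) : {B // B ∈ V} := next^[n] ⟨A 0, hA 0⟩
  have hB : ∀ n, B (n + 1) = next (B n) := fun n => Function.iterate_succ_apply' _ _ _
  have hBs : ∀ n y, y ∈ (B (n + 1)).1 → ((y ∈ (B n).1 ∧ (pick (B n)).union y ∈ (B n).1) ∧
      (pick (B n)).max < y.min) ∧ y ∈ A (pick (B n)).max := fun n y hy => by
    rw [hB] at hy
    exact hy
  have hanti : Antitone fun n => (B n).1 := antitone_nat_of_succ_le fun n y hy => (hBs n y hy).1.1.1
  let Y : BlockSeq := ⟨fun n => pick (B n), fun n => (hBs n _ (pick_mem (B (n + 1)))).1.2⟩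
  -- The least index `a` is added last: the union over the other indices lies in `B (a + 1)`, so its
  -- union with `pick (B a)` lies in `B a`.
  have key : ∀ s : Finset ℕ, ∀ (hs : s.Nonempty) (n : ℕ), (∀ i ∈ s, n ≤ i) →
      Y.app ⟨s, hs⟩ ∈ (B n).1 := by
    intro s
    induction s using Finset.induction_on_min with
    | empty => intro hs; exact absurd hs Finset.not_nonempty_empty
    | insert a s ha ih =>
      intro hs n hn
      have han : (B a).1 ⊆ (B n).1 := hanti (hn a (Finset.mem_insert_self _ _))
      rcases s.eq_empty_or_nonempty with rfl | hs'
      · have : Y.app ⟨insert a ∅, hs⟩ = pick (B a) := Y.app_single a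
        exact this ▸ han (pick_mem _)
      · have h2 := (hBs a _ (ih hs' (a + 1) fun i hi => ha i hi)).1.1.2
        have : Y.app ⟨insert a s, hs⟩ = (pick (B a)).union (Y.app ⟨s, hs'⟩) := by
          have := Y.app_union (FIN.single a) ⟨s, hs'⟩
          rw [Y.app_single] at this
          exact this
        exact this ▸ han h2
  have hspan : ∀ n, (Y.tail n).span ⊆ (B n).1 := by
    intro n y hy
    rcases n with _ | n
    · obtain ⟨I, rfl⟩ := Y.mem_span.1 (Y.tail_span_subset 0 hy)
      exact key I.1 I.2 0 fun i _ => i.zero_le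
    · obtain ⟨I, rfl⟩ := Y.mem_span.1 (Y.tail_span_subset (n + 1) hy)
      refine key I.1 I.2 _ fun i hi => ?_
      have := Y.lt_min_of_mem_tail_span hy
      rw [Y.min_app] at this
      by_contra! hlt
      have h2 := Y.strictMono_min.monotone ((I.min_le hi).trans (Nat.le_of_lt_succ hlt))
      have h3 := (Y.1 n).min_le_max
      change (Y.1 I.min).min ≤ (Y.1 n).min at h2
      omega
  refine ⟨Y, fun y hy => ?_, fun i y hy => (hBs i y (hspan _ hy)).2⟩
  obtain ⟨I, rfl⟩ := Y.mem_span.1 hy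
  exact key I.1 I.2 0 fun i _ => i.zero_le

/-- `Y` decides the sequence `A`: its span is disjoint from some term, or it diagonalizes `A`. -/
def BlockSeq.Decides (Y : BlockSeq) (A : ℕ → Set FIN) : Prop :=
  (∃ n, Disjoint Y.span (A n)) ∨
    (Y.span ⊆ A 0 ∧ ∀ i, (Y.tail (i + 1)).span ⊆ A (Y.1 i).max)

theorem BlockSeq.exists_decides (X : BlockSeq) (A : ℕ → Set FIN) :
    ∃ Y : BlockSeq, Y.span ⊆ X.span ∧ Y.Decides A := by
  obtain ⟨V, hX, hV⟩ := X.exists_idempotent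
  have hmin : ∀ n, {x : FIN | n < x.min} ∈ V := fun n =>
    Filter.mem_of_superset (hX (n + 1)) fun y hy =>
      (X.le_max n).trans_lt (X.lt_min_of_mem_tail_span hy)
  have hX0 : X.span ∈ V := Filter.mem_of_superset (hX 0) (X.tail_span_subset 0)
  by_cases h : ∀ n, A n ∈ V
  · obtain ⟨Y, h0, hY⟩ := exists_diagonal hV hmin (A := fun n => A n ∩ X.span)
      fun n => Filter.inter_mem (h n) hX0
    exact ⟨Y, fun y hy => (h0 hy).2, Or.inr ⟨fun y hy => (h0 hy).1, fun i y hy => (hY i hy).1⟩⟩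
  · push Not at h
    obtain ⟨n, hn⟩ := h
    obtain ⟨Y, h0, -⟩ := exists_diagonal hV hmin (A := fun _ => (A n)ᶜ ∩ X.span)
      fun _ => Filter.inter_mem (Ultrafilter.compl_mem_iff_notMem.2 hn) hX0
    exact ⟨Y, fun y hy => (h0 hy).2, Or.inl ⟨n, Set.disjoint_left.2 fun y hy => (h0 hy).1⟩⟩

/-- A block sequence can be chosen with prescribed constraints on its terms, each of which is met
by elements arbitrarily far out. -/
theorem BlockSeq.exists_forall_mem {S : ℕ → Set FIN} (hS : ∀ n N, ∃ x ∈ S n, N < x.min) :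
    ∃ Y : BlockSeq, ∀ n, Y.1 n ∈ S n := by
  choose f hf hlt using hS
  let y : ℕ → FIN := fun n => Nat.rec (f 0 0) (fun n x => f (n + 1) x.max) n
  exact ⟨⟨y, fun n => hlt (n + 1) (y n).max⟩, fun n => n.casesOn (hf _ _) fun n => hf _ _⟩

/-! ### Killing a candidate Tukey reduction -/

section Splitting

variable {α β : Type*} (π : FIN → α) (ρ : FIN → β)

/-- Below every block sequence there are two with the same values of `π` and disjoint sets of values
of `ρ` on their spans. -/
def Splits : Prop :=
  ∀ X : BlockSeq, ∃ Y Y' : BlockSeq, Y.span ⊆ X.span ∧ Y'.span ⊆ X.span ∧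
    (∀ I, π (Y.app I) = π (Y'.app I)) ∧ ∀ I I', ρ (Y.app I) ≠ ρ (Y'.app I')

/-- The intersection of the second components of those pairs in `q` whose first component has a
`π`-image containing that of `Z`. -/
def approxHull (q : ℕ → Set FIN × Set FIN) (Z : Set FIN) : Set FIN :=
  {k | ∀ i, π '' Z ⊆ π '' (q i).1 → k ∈ (q i).2}

/-- `W` prevents the approximation `q` from giving a Tukey reduction of the `ρ`-image to the
`π`-image of an ultrafilter containing the span of `W`. -/
def BlockSeq.Defeats (W : BlockSeq) (q : ℕ → Set FIN × Set FIN) : Prop :=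
  Disjoint W.span (approxHull π q W.span) ∨
    ∀ Z : BlockSeq, Z.span ⊆ W.span → ¬ approxHull π q Z.span ⊆ ρ ⁻¹' (ρ '' W.span)

variable {π ρ}

/-- The hull of a span depends only on its `π`-image. If below `X` every span meets its own hull,
then for `Z` below `Y` the copy of `Z` inside `Y'` has the same hull, so this hull contains a point
of `Y'.span`, whose `ρ`-value is not taken on `Y.span`. -/
theorem Splits.exists_defeats (h : Splits π ρ) (X : BlockSeq) (q : ℕ → Set FIN × Set FIN) :
    ∃ W : BlockSeq, W.span ⊆ X.span ∧ W.Defeats π ρ q := by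
  by_cases hX : ∃ W : BlockSeq, W.span ⊆ X.span ∧ Disjoint W.span (approxHull π q W.span)
  · obtain ⟨W, hW, h⟩ := hX
    exact ⟨W, hW, Or.inl h⟩
  push Not at hX
  obtain ⟨Y, Y', hY, hY', hπ, hρ⟩ := h X
  refine ⟨Y, hY, Or.inr fun Z hZ hsub => ?_⟩
  obtain ⟨J, rfl⟩ := BlockSeq.exists_comp hZ
  have himage : π '' (Y'.comp J).span = π '' (Y.comp J).span := by
    simp only [BlockSeq.span_eq_range, ← Set.range_comp]
    exact congrArg Set.range (funext fun I => by simp [BlockSeq.comp_app, hπ])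
  obtain ⟨x, hx, hx'⟩ :=
    Set.not_disjoint_iff.1 (hX (Y'.comp J) ((Y'.comp_span_subset J).trans hY'))
  rw [approxHull, himage] at hx'
  obtain ⟨y, hy, hyx⟩ := hsub hx'
  obtain ⟨I, rfl⟩ := Y.mem_span.1 hy
  obtain ⟨I', rfl⟩ := Y'.mem_span.1 (Y'.comp_span_subset J hx)
  exact hρ I I' hyx

theorem splits_of_index {J J' : BlockSeq}
    (h : ∀ (X : BlockSeq) I, π (X.app (J.app I)) = π (X.app (J'.app I)))
    (h' : ∀ (X : BlockSeq) I I', ρ (X.app (J.app I)) ≠ ρ (X.app (J'.app I'))) : Splits π ρ :=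
  fun X => ⟨X.comp J, X.comp J', X.comp_span_subset J, X.comp_span_subset J',
    fun I => by simpa [BlockSeq.comp_app] using h X I,
    fun I I' => by simpa [BlockSeq.comp_app] using h' X I I'⟩

end Splitting

/-- The block sequence of sets `F n` lying in the successive intervals of length `k`. -/
def BlockSeq.ofDiv (k : ℕ) (F : ℕ → FIN) (h : ∀ n, ∀ m ∈ (F n).1, m / k = n) : BlockSeq :=
  ⟨F, fun n => by
    have h1 := h n _ (F n).max_mem
    have h2 := h (n + 1) _ (F (n + 1)).min_mem
    by_contra! hle
    have := Nat.div_le_div_right (c := k) hle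
    omega⟩

@[simp] theorem BlockSeq.ofDiv_apply (k : ℕ) (F : ℕ → FIN) (h : ∀ n, ∀ m ∈ (F n).1, m / k = n)
    (n : ℕ) : (ofDiv k F h).1 n = F n := rfl

/-! ### Index patterns witnessing the three splittings -/

namespace FIN

/-- The set `{m, n}`. -/
def pair (m n : ℕ) : FIN := ⟨{m, n}, Finset.insert_nonempty _ _⟩

theorem mem_single {m n : ℕ} : m ∈ (single n).1 ↔ m = n := Finset.mem_singleton

theorem mem_pair {k m n : ℕ} : k ∈ (pair m n).1 ↔ k = m ∨ k = n := by simp [pair]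

theorem mem_union {k : ℕ} {x y : FIN} : k ∈ (x.union y).1 ↔ k ∈ x.1 ∨ k ∈ y.1 :=
  Finset.mem_union

@[simp] theorem min_single (n : ℕ) : (single n).min = n :=
  min_eq (by simp [single]) (by simp [single])

@[simp] theorem max_single (n : ℕ) : (single n).max = n :=
  max_eq (by simp [single]) (by simp [single])

theorem min_pair {m n : ℕ} (h : m ≤ n) : (pair m n).min = m :=
  min_eq (by simp [pair]) (by simpa [pair] using h)

theorem max_pair {m n : ℕ} (h : m ≤ n) : (pair m n).max = n :=
  max_eq (by simp [pair]) (by simpa [pair] using h)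

/-- The blocks `{2n}` and `{2n, 2n+1}` have the same minima, while their maxima differ in parity. -/
theorem splits_min_max : Splits min max := by
  refine splits_of_index (J := BlockSeq.ofDiv 2 (fun n => single (2 * n)) ?_)
    (J' := BlockSeq.ofDiv 2 (fun n => pair (2 * n) (2 * n + 1)) ?_) ?_ ?_
  · intro n m hm
    rw [mem_single] at hm
    omega
  · intro n m hm
    rw [mem_pair] at hm
    omega
  · intro X I
    simp [BlockSeq.min_app, min_pair]
  · intro X I I' h
    simp only [BlockSeq.max_app, BlockSeq.ofDiv_apply, max_single, max_pair (Nat.le_succ _)] at h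
    have := X.strictMono_max.injective h
    omega

theorem splits_max_min : Splits max min := by
  refine splits_of_index (J := BlockSeq.ofDiv 2 (fun n => single (2 * n + 1)) ?_)
    (J' := BlockSeq.ofDiv 2 (fun n => pair (2 * n) (2 * n + 1)) ?_) ?_ ?_
  · intro n m hm
    rw [mem_single] at hm
    omega
  · intro n m hm
    rw [mem_pair] at hm
    omega
  · intro X I
    simp [BlockSeq.max_app, max_pair]
  · intro X I I' h
    simp only [BlockSeq.min_app, BlockSeq.ofDiv_apply, min_single, min_pair (Nat.le_succ _)] at h
    have := X.strictMono_min.injective h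
    omega

/-- The blocks `{3n, 3n+1, 3n+2}` and `{3n, 3n+2}` have the same endpoints; only the first kind
contains numbers congruent to 1 modulo 3. -/
theorem splits_minMax_id : Splits minMax id := by
  have hp : ∀ n, ((pair (3 * n) (3 * n + 2)).union (single (3 * n + 1))).min = 3 * n := fun n =>
    min_eq (by simp [mem_union, mem_pair]) fun m hm => by
      rw [mem_union, mem_pair, mem_single] at hm
      omega
  have hq : ∀ n, ((pair (3 * n) (3 * n + 2)).union (single (3 * n + 1))).max = 3 * n + 2 :=
    fun n => max_eq (by simp [mem_union, mem_pair]) fun m hm => by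
      rw [mem_union, mem_pair, mem_single] at hm
      omega
  refine splits_of_index
    (J := BlockSeq.ofDiv 3 (fun n => (pair (3 * n) (3 * n + 2)).union (single (3 * n + 1))) ?_)
    (J' := BlockSeq.ofDiv 3 (fun n => pair (3 * n) (3 * n + 2)) ?_) ?_ ?_
  · intro n m hm
    rw [mem_union, mem_pair, mem_single] at hm
    omega
  · intro n m hm
    rw [mem_pair] at hm
    omega
  · intro X I
    simp [minMax, BlockSeq.max_app, BlockSeq.min_app, min_pair, max_pair, hp, hq]
  · intro X I I' h
    have h := X.app_injective h
    obtain ⟨i, hi⟩ := I.2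
    have : 3 * i + 1 ∈ (BlockSeq.app (BlockSeq.ofDiv 3 _ _) I').1 :=
      h ▸ (BlockSeq.mem_app _).2 ⟨i, hi, mem_union.2 (Or.inr (mem_single.2 rfl))⟩
    obtain ⟨j, -, hj⟩ := (BlockSeq.mem_app _).1 this
    have := mem_pair.1 hj
    omega

end FIN

/-! ### Towers of block sequences and the generic ultrafilter -/

namespace BlockSeq

instance : Inhabited BlockSeq := ⟨ofDiv 1 FIN.single fun n m hm => by
  rw [FIN.mem_single] at hm
  simpa using hm⟩

/-- All but finitely many terms of `Y` are in the span of `X`. -/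
def AlmostLE (Y X : BlockSeq) : Prop := ∃ n, (Y.tail n).span ⊆ X.span

theorem exists_mem_tail_span (X : BlockSeq) (n N : ℕ) : ∃ x ∈ (X.tail n).span, N < x.min :=
  ⟨(X.tail n).1 (N + 1), apply_mem_span _ _, (X.tail n).le_min (N + 1)⟩

theorem exists_almostLE_of_countable {ι : Type*} [LinearOrder ι] [Countable ι] {X : ι → BlockSeq}
    (h : ∀ i j, j < i → (X i).AlmostLE (X j)) : ∃ Y : BlockSeq, ∀ i, Y.AlmostLE (X i) := by
  rcases isEmpty_or_nonempty ι with _ | _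
  · exact ⟨default, fun i => isEmptyElim i⟩
  obtain ⟨e, he⟩ := exists_surjective_nat ι
  have key : ∀ m N, ∃ x ∈ {x : FIN | ∀ n ≤ m, x ∈ (X (e n)).span}, N < x.min := by
    intro m N
    -- Among the first `m + 1` sequences the one of largest index is almost below all the others, so
    -- a far tail of it lies in all their spans.
    obtain ⟨n₀, -, hn₀⟩ :=
      Finset.exists_max_image (Finset.range (m + 1)) e ⟨0, Finset.mem_range.2 m.succ_pos⟩
    have hk : ∀ n, ∃ k, n ≤ m → ((X (e n₀)).tail k).span ⊆ (X (e n)).span := fun n => by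
      by_cases hn : n ≤ m
      · rcases (hn₀ n (by simpa using Nat.lt_succ_of_le hn)).lt_or_eq with hlt | heq
        · obtain ⟨k, hk⟩ := h _ _ hlt
          exact ⟨k, fun _ => hk⟩
        · exact ⟨0, fun _ => heq ▸ tail_span_subset _ _⟩
      · exact ⟨0, fun h => absurd h hn⟩
    choose k hk using hk
    obtain ⟨x, hx, hN⟩ := exists_mem_tail_span (X (e n₀)) ((Finset.range (m + 1)).sup k) N
    refine ⟨x, fun n hn => hk n hn (tail_span_anti _ (Finset.le_sup ?_) hx), hN⟩
    simpa using Nat.lt_succ_of_le hn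
  obtain ⟨Y, hY⟩ := exists_forall_mem key
  refine ⟨Y, fun i => ?_⟩
  obtain ⟨n, rfl⟩ := he i
  exact ⟨n, span_subset_span fun k => hY (n + k) n (Nat.le_add_right n k)⟩

theorem exists_tower {ι : Type*} [LinearOrder ι] [WellFoundedLT ι]
    (hι : ∀ i : ι, (Set.Iio i).Countable) {D : ι → Set BlockSeq}
    (hD : ∀ i (X : BlockSeq), ∃ Y ∈ D i, Y.span ⊆ X.span) :
    ∃ X : ι → BlockSeq, (∀ i, X i ∈ D i) ∧ ∀ i j, j < i → (X i).AlmostLE (X j) := by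
  classical
  let step (i : ι) (f : ∀ j, j < i → BlockSeq) : BlockSeq :=
    -- The default is never taken: `key` shows by induction that a suitable `W` exists at each
    -- stage.
    if h : ∃ W ∈ D i, ∀ j hj, W.AlmostLE (f j hj) then h.choose else default
  let X : ι → BlockSeq := (wellFounded_lt (α := ι)).fix step
  have hX : ∀ i, (∃ W ∈ D i, ∀ j < i, W.AlmostLE (X j)) → X i ∈ D i ∧
      ∀ j < i, (X i).AlmostLE (X j) := fun i h => by
    have : X i = h.choose := by
      rw [show X i = step i fun j _ => X j from WellFounded.fix_eq _ _ _]
      exact dif_pos h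
    exact this ▸ h.choose_spec
  have key : ∀ i, X i ∈ D i ∧ ∀ j < i, (X i).AlmostLE (X j) := fun i => by
    induction i using WellFoundedLT.induction with
    | ind i ih =>
      have := (hι i).to_subtype
      obtain ⟨Y, hY⟩ := exists_almostLE_of_countable (X := fun j : Set.Iio i => X j)
        fun j k hkj => (ih j j.2).2 k hkj
      obtain ⟨W, hW, hWY⟩ := hD i Y
      refine hX i ⟨W, hW, fun j hj => ?_⟩
      obtain ⟨n, hn⟩ := hY ⟨j, hj⟩
      refine ⟨(Y.1 n).max + 1, fun x hx => hn ?_⟩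
      refine Y.mem_tail_span (hWY (tail_span_subset _ _ hx)) fun k hk => ?_
      exact ((Y.strictMono_min hk).trans_le ((Y.1 n).min_le_max.trans
        (W.le_max _))).trans (W.lt_min_of_mem_tail_span hx)
  exact ⟨X, fun i => (key i).1, fun i => (key i).2⟩

/-- The tail spans of the tower form a filter base, and the generated filter is already an
ultrafilter because the tower decides every set. -/
theorem exists_ultrafilter_of_tower {ι : Type*} [LinearOrder ι] [Nonempty ι] {X : ι → BlockSeq}
    (h : ∀ i j, j < i → (X i).AlmostLE (X j))
    (hX : ∀ A : Set FIN, ∃ i, (X i).span ⊆ A ∨ Disjoint (X i).span A) :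
    ∃ U : Ultrafilter FIN, (∀ n, {x : FIN | n < x.min} ∈ U) ∧ (∀ i, (X i).span ∈ U) ∧
      ∀ A ∈ U, ∃ Y : BlockSeq, Y.span ∈ U ∧ Y.span ⊆ A := by
  let B (p : ι × ℕ) : Set FIN := ((X p.1).tail p.2).span
  have hdir : Directed (· ≥ ·) fun p => Filter.principal (B p) := by
    have aux : ∀ i j m n, j ≤ i → ∃ k, B (i, k) ⊆ B (i, m) ∧ B (i, k) ⊆ B (j, n) := by
      intro i j m n hij
      rcases hij.lt_or_eq with hlt | rfl
      · obtain ⟨k, hk⟩ := h i j hlt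
        refine ⟨Max.max m (Max.max k (((X j).1 n).max + 1)), tail_span_anti _ (le_max_left _ _),
          fun x hx => ?_⟩
        refine (X j).mem_tail_span (hk (tail_span_anti _ (by simp) hx)) fun l hl => ?_
        have hx' : x ∈ ((X i).tail (((X j).1 n).max + 1)).span :=
          tail_span_anti _ (by simp) hx
        exact (((X j).strictMono_min hl).trans_le (((X j).1 n).min_le_max.trans
          ((X i).le_max _))).trans ((X i).lt_min_of_mem_tail_span hx')
      · exact ⟨Max.max m n, tail_span_anti _ (le_max_left _ _), tail_span_anti _ (le_max_right _ _)⟩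
    rintro ⟨i, m⟩ ⟨j, n⟩
    rcases le_total j i with hij | hij
    · obtain ⟨k, h1, h2⟩ := aux i j m n hij
      exact ⟨(i, k), Filter.principal_mono.2 h1, Filter.principal_mono.2 h2⟩
    · obtain ⟨k, h1, h2⟩ := aux j i n m hij
      exact ⟨(j, k), Filter.principal_mono.2 h2, Filter.principal_mono.2 h1⟩
  have hmem : ∀ A, A ∈ (⨅ p, Filter.principal (B p)) ↔ ∃ p, B p ⊆ A := fun A => by
    rw [Filter.mem_iInf_of_directed hdir]
    rfl
  have hcompl : ∀ A, Aᶜ ∉ (⨅ p, Filter.principal (B p)) ↔ A ∈ (⨅ p, Filter.principal (B p)) := by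
    intro A
    rw [hmem, hmem]
    constructor
    · intro hA
      obtain ⟨i, hi | hi⟩ := hX A
      · exact ⟨(i, 0), (tail_span_subset _ _).trans hi⟩
      · exact absurd ⟨(i, 0), (tail_span_subset _ _).trans hi.subset_compl_right⟩ hA
    · rintro ⟨p, hp⟩ ⟨q, hq⟩
      obtain ⟨r, h1, h2⟩ := hdir p q
      rw [ge_iff_le, Filter.principal_mono] at h1 h2
      exact hq (h2 (apply_mem_span _ 0)) (hp (h1 (apply_mem_span _ 0)))
  refine ⟨Ultrafilter.ofComplNotMemIff _ hcompl, fun n => ?_, fun i => ?_, fun A hA => ?_⟩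
  · obtain ⟨i⟩ := ‹Nonempty ι›
    exact (hmem _).2 ⟨(i, n + 1), fun x hx => ((X i).le_max n).trans_lt
      ((X i).lt_min_of_mem_tail_span hx)⟩
  · exact (hmem _).2 ⟨(i, 0), tail_span_subset _ _⟩
  · obtain ⟨p, hp⟩ := (hmem A).1 hA
    exact ⟨(X p.1).tail p.2, (hmem _).2 ⟨p, subset_rfl⟩, hp⟩

/-- Under the continuum hypothesis, there is a generic ultrafilter for at most continuum many dense
sets of block sequences. -/
theorem exists_generic_ultrafilter (CH : Cardinal.aleph.{0} 1 = Cardinal.continuum.{0}) {Q : Type}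
    (hQ : Cardinal.mk Q ≤ Cardinal.continuum) {D : Q → Set BlockSeq}
    (hD : ∀ q (X : BlockSeq), ∃ Y ∈ D q, Y.span ⊆ X.span)
    (hdec : ∀ A : Set FIN, ∃ q, ∀ X ∈ D q, X.span ⊆ A ∨ Disjoint X.span A) :
    ∃ U : Ultrafilter FIN, (∀ n, {x : FIN | n < x.min} ∈ U) ∧
      (∀ A ∈ U, ∃ Y : BlockSeq, Y.span ∈ U ∧ Y.span ⊆ A) ∧
      ∀ q, ∃ Y ∈ D q, Y.span ∈ U := by
  let ι := (Cardinal.aleph.{0} 1).ord.ToType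
  have hι : Cardinal.mk ι = Cardinal.aleph 1 := Cardinal.mk_ord_toType _
  have : Nonempty Q := ⟨(hdec ∅).choose⟩
  have hne : Nonempty ι := by
    rw [← Cardinal.mk_ne_zero_iff, hι]
    exact (Cardinal.aleph_pos 1).ne'
  obtain ⟨e, he⟩ : ∃ e : ι → Q, Function.Surjective e := by
    obtain ⟨f⟩ : Nonempty (Q ↪ ι) := by
      rw [← Cardinal.le_def, hι, CH]
      exact hQ
    exact ⟨_, Function.invFun_surjective f.injective⟩
  have hcount : ∀ i : ι, (Set.Iio i).Countable := fun i => by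
    rw [← Cardinal.le_aleph0_iff_set_countable, ← Cardinal.lt_aleph_one_iff]
    exact (Cardinal.mk_Iio_lt i (by simp [ι])).trans_eq hι
  obtain ⟨X, hXD, hX⟩ := exists_tower hcount (D := fun i => D (e i)) fun i => hD (e i)
  obtain ⟨U, h1, h2, h3⟩ := exists_ultrafilter_of_tower hX fun A => by
    obtain ⟨q, hq⟩ := hdec A
    obtain ⟨i, rfl⟩ := he q
    exact ⟨i, hq _ (hXD i)⟩
  refine ⟨U, h1, h3, fun q => ?_⟩
  obtain ⟨i, rfl⟩ := he q
  exact ⟨X i, hXD i, h2 i⟩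

end BlockSeq

/-! ### Tukey reductions between ultrafilters -/

section Tukey

theorem TukeyLE.trans {D E F : Type*} [Preorder D] [Preorder E] [Preorder F]
    (h : TukeyLE D E) (h' : TukeyLE E F) : TukeyLE D F := by
  obtain ⟨f, hf⟩ := h
  obtain ⟨g, hg⟩ := h'
  exact ⟨f ∘ g, fun C hC => Set.image_comp f g C ▸ hf _ (hg _ hC)⟩

theorem tukeyLE_map {α β : Type*} (f : α → β) (U : Ultrafilter α) :
    TukeyLE (UltrafilterOrder (U.map f)) (UltrafilterOrder U) := by
  refine ⟨fun s => OrderDual.toDual ⟨f '' (OrderDual.ofDual s).1,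
    Filter.image_mem_map (OrderDual.ofDual s).2⟩, fun C hC t => ?_⟩
  obtain ⟨c, hc, hle⟩ := hC (OrderDual.toDual ⟨f ⁻¹' (OrderDual.ofDual t).1, (OrderDual.ofDual t).2⟩)
  exact ⟨_, ⟨c, hc, rfl⟩, Set.image_subset_iff.2 hle⟩

theorem tukeyLT_unit {V : Ultrafilter ℕ} (hV : ∀ n, {k | n < k} ∈ V) :
    TukeyLT Unit (UltrafilterOrder V) := by
  refine ⟨⟨fun _ => (), fun C hC _ => ?_⟩, fun ⟨f, hf⟩ => ?_⟩
  · obtain ⟨c, hc, -⟩ := hC (OrderDual.toDual ⟨Set.univ, Filter.univ_mem⟩)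
    exact ⟨(), ⟨c, hc, rfl⟩, le_rfl⟩
  · obtain ⟨n, hn⟩ := V.nonempty_of_mem (OrderDual.ofDual (f ())).2
    obtain ⟨_, ⟨_, -, rfl⟩, h⟩ := hf Set.univ IsCofinal.univ (OrderDual.toDual ⟨_, hV n⟩)
    exact lt_irrefl n (h hn)

/-- A Tukey reduction between ultrafilters can be replaced by a monotone one. -/
theorem TukeyLE.exists_monotone {α β : Type*} {W : Ultrafilter β} {V : Ultrafilter α}
    (h : TukeyLE (UltrafilterOrder W) (UltrafilterOrder V)) :
    ∃ g : Set α → Set β, Monotone g ∧ (∀ S ∈ V, g S ∈ W) ∧ ∀ C ∈ W, ∃ S ∈ V, g S ⊆ C := by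
  obtain ⟨f, hf⟩ := h
  -- Otherwise the `X'` with `¬ Y ≤ f X'` are cofinal, yet no point of their image is above `Y`.
  have key : ∀ Y : UltrafilterOrder W, ∃ X : UltrafilterOrder V, ∀ X', X ≤ X' → Y ≤ f X' := by
    intro Y
    by_contra! hY
    obtain ⟨_, ⟨X, hX, rfl⟩, hle⟩ := hf {X' | ¬ Y ≤ f X'} (fun X => by
      obtain ⟨X', h, h'⟩ := hY X
      exact ⟨X', h', h⟩) Y
    exact hX hle
  choose m hm using key
  refine ⟨fun S => {b | ∀ Y, S ⊆ (OrderDual.ofDual (m Y)).1 → b ∈ (OrderDual.ofDual Y).1},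
    fun S T hST b hb Y hY => hb Y (hST.trans hY), fun S hS => ?_, fun C hC => ?_⟩
  · exact Filter.mem_of_superset (OrderDual.ofDual (f (OrderDual.toDual ⟨S, hS⟩))).2
      fun b hb Y hY => hm Y (OrderDual.toDual ⟨S, hS⟩) hY hb
  · exact ⟨_, (OrderDual.ofDual (m (OrderDual.toDual ⟨C, hC⟩))).2, fun b hb => hb _ subset_rfl⟩

end Tukey

/-- An ultrafilter containing all final segments of `FIN` in which every sequence of members is
diagonalized by a block sequence. -/
structure IsStable (U : Ultrafilter FIN) : Prop where
  lt_min_mem : ∀ n, {x : FIN | n < x.min} ∈ U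
  exists_diagonal : ∀ A : ℕ → Set FIN, (∀ n, A n ∈ U) → ∃ Y : BlockSeq, Y.span ∈ U ∧
    Y.span ⊆ A 0 ∧ ∀ i, (Y.tail (i + 1)).span ⊆ A (Y.1 i).max

/-! ### Consequences of stability -/

namespace IsStable

variable {U : Ultrafilter FIN} (hU : IsStable U)

include hU

theorem exists_span_subset {A : Set FIN} (hA : A ∈ U) : ∃ Y : BlockSeq, Y.span ∈ U ∧ Y.span ⊆ A := by
  obtain ⟨Y, hY, h, -⟩ := hU.exists_diagonal (fun _ => A) fun _ => hA
  exact ⟨Y, hY, h⟩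

theorem tail_mem {X : BlockSeq} (hX : X.span ∈ U) (n : ℕ) : (X.tail n).span ∈ U := by
  filter_upwards [hX, hU.lt_min_mem (X.1 n).min] with y hy hlt
  exact X.mem_tail_span hy fun i hi => (X.strictMono_min hi).trans hlt

theorem eventually_union_mem {A : Set FIN} (hA : A ∈ U) :
    {x : FIN | {y : FIN | x.max < y.min ∧ x.union y ∈ A} ∈ U} ∈ U := by
  obtain ⟨X, hX, hXA⟩ := hU.exists_span_subset hA
  filter_upwards [hX] with x hx
  filter_upwards [hX, hU.lt_min_mem x.max] with y hy hlt
  exact ⟨hlt, hXA (X.union_mem_span hx hy)⟩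

theorem isIdempotentUltrafilter : IsIdempotentUltrafilter U := by
  refine fun A => ⟨hU.eventually_union_mem, fun h => ?_⟩
  by_contra hA
  obtain ⟨x, hx, hx'⟩ := U.nonempty_of_mem
    (Filter.inter_mem h (hU.eventually_union_mem (Ultrafilter.compl_mem_iff_notMem.2 hA)))
  obtain ⟨y, hy, hy'⟩ := U.nonempty_of_mem (Filter.inter_mem hx hx')
  exact hy'.2 hy.2

theorem isBlockBasic : IsBlockBasic U := by
  refine ⟨⟨hU.isIdempotentUltrafilter, fun A hA => hU.exists_span_subset hA⟩, ?_⟩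
  intro X Y hX hY hXY
  obtain ⟨φ, hφ, hφY⟩ := Filter.extraction_forall_of_eventually
    (P := fun l n => ∀ k ≤ l, (X n).1 k = Y.1 k) fun l => by
      obtain ⟨m, hm⟩ := hXY l
      exact Filter.eventually_atTop.2 ⟨m, hm⟩
  obtain ⟨Z, hZ, hZ0, hZt⟩ := hU.exists_diagonal (fun m => (X (φ m)).span ∩ Y.span)
    fun m => Filter.inter_mem (hX _) hY
  refine ⟨fun k => φ (Z.1 k).max, hφ.comp Z.strictMono_max, Filter.mem_of_superset hZ ?_⟩
  refine Set.subset_iInter fun k => BlockSeq.span_subset_span fun j => ?_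
  -- For `j ≤ k`, the term `Z.1 j` uses only terms of `Y` of index at most `(Z.1 k).max`, where `X
  -- (φ (Z.1 k).max)` agrees with `Y`. For `j > k` the diagonalization applies.
  rcases le_or_gt j k with hjk | hkj
  · obtain ⟨I, hI⟩ := Y.mem_span.1 (hZ0 (Z.apply_mem_span j)).2
    refine (BlockSeq.mem_span _).2 ⟨I, hI ▸ Subtype.ext (Finset.biUnion_congr rfl fun i hi => ?_)⟩
    refine congrArg Subtype.val (hφY _ i ?_)
    have : (Y.1 i).max ≤ (Z.1 j).max :=
      hI ▸ (Y.app I).le_max (Y.mem_app.2 ⟨i, hi, (Y.1 i).max_mem⟩)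
    exact ((Y.le_max i).trans this).trans (Z.strictMono_max.monotone hjk)
  · exact (hZt k (Z.mem_tail_span (Z.apply_mem_span j) fun i hi =>
      Z.strictMono_min (by omega))).1

/-- If `f` is constant on no member, diagonalizing makes `f ∘ r` avoid, at each term, its values at
all earlier terms; by `happ` the terms realize every value of `r` on the span. -/
theorem isSelective_map {r : FIN → ℕ} (hr : ∀ x, r x ≤ x.max)
    (happ : ∀ (X : BlockSeq) I, ∃ i, r (X.app I) = r (X.1 i)) : IsSelective (U.map r) := by
  intro f
  by_cases hc : ∃ c, {n | f n = c} ∈ U.map r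
  · obtain ⟨c, hc⟩ := hc
    exact ⟨_, hc, Or.inl ⟨c, fun n hn => hn⟩⟩
  push Not at hc
  obtain ⟨Y, hY, -, hYt⟩ := hU.exists_diagonal
    (fun n => ⋂ m ∈ Finset.range (n + 1), {x | f (r x) ≠ f m}) fun n =>
      (Filter.biInter_finset_mem _).2 fun m _ => Ultrafilter.compl_mem_iff_notMem.2 (hc (f m))
  refine ⟨_, Filter.image_mem_map hY, Or.inr ?_⟩
  have key : ∀ i j, i < j → f (r (Y.1 j)) ≠ f (r (Y.1 i)) := fun i j hij => by
    have := hYt i (Y.mem_tail_span (Y.apply_mem_span j) fun k hk => Y.strictMono_min (by omega))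
    exact Set.mem_iInter₂.1 this (r (Y.1 i)) (by simpa using Nat.lt_succ_of_le (hr _))
  rintro _ ⟨x, hx, rfl⟩ _ ⟨y, hy, rfl⟩ h
  obtain ⟨I, rfl⟩ := Y.mem_span.1 hx
  obtain ⟨J, rfl⟩ := Y.mem_span.1 hy
  obtain ⟨i, hi⟩ := happ Y I
  obtain ⟨j, hj⟩ := happ Y J
  rw [hi, hj] at h ⊢
  rcases lt_trichotomy i j with hij | rfl | hij
  exacts [absurd h.symm (key i j hij), rfl, absurd h (key j i hij)]

/-- `p`, `B` and the unions of elements of `p` with elements of `B`. -/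
abbrev extend (p B : Set FIN) : Set FIN := p ∪ B ∪ Set.image2 FIN.union p B

omit hU in
theorem extend_mono (p : Set FIN) {B B' : Set FIN} (h : B ⊆ B') : extend p B ⊆ extend p B' :=
  Set.union_subset_union (Set.union_subset_union_right _ h) (Set.image2_subset_left h)

omit hU in
theorem span_eq_extend (Z : BlockSeq) (j : ℕ) :
    Z.span = extend {x ∈ Z.span | x.max ≤ (Z.1 j).max} (Z.tail (j + 1)).span := by
  refine Set.Subset.antisymm (fun y hy => ?_) ?_
  · obtain ⟨I, rfl⟩ := Z.mem_span.1 hy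
    rcases le_or_gt I.max j with h | h
    · exact Or.inl (Or.inl ⟨hy, by rw [Z.max_app]; exact Z.strictMono_max.monotone h⟩)
    rcases lt_or_ge j I.min with h' | h'
    · exact Or.inl (Or.inr (Z.mem_tail_span_of_lt hy (by rw [Z.min_app]; exact Z.max_lt_min h')))
    let I₁ : FIN := ⟨I.1.filter (· ≤ j), I.min, Finset.mem_filter.2 ⟨I.min_mem, h'⟩⟩
    let I₂ : FIN := ⟨I.1.filter (¬ · ≤ j), I.max, Finset.mem_filter.2 ⟨I.max_mem, h.not_ge⟩⟩
    refine Or.inr ⟨Z.app I₁, ⟨Z.app_mem_span _, ?_⟩, Z.app I₂,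
      Z.mem_tail_span_of_lt (Z.app_mem_span _) ?_, ?_⟩
    · rw [Z.max_app]
      exact Z.strictMono_max.monotone (Finset.mem_filter.1 I₁.max_mem).2
    · rw [Z.min_app]
      exact Z.max_lt_min (not_le.1 (Finset.mem_filter.1 I₂.min_mem).2)
    · rw [← Z.app_union]
      exact congrArg Z.app (Subtype.ext (Finset.filter_union_filter_not_eq _ _))
  · refine Set.union_subset (Set.union_subset (fun x hx => hx.1) (Z.tail_span_subset _)) ?_
    rintro _ ⟨x, hx, y, hy, rfl⟩
    exact Z.union_mem_span hx.1 (Z.tail_span_subset _ hy)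

/-- A monotone map on a stable ultrafilter is determined on a base by countably many values. -/
theorem exists_approx {g : Set FIN → Set FIN} (hg : Monotone g) :
    ∃ q : ℕ → Set FIN × Set FIN, (∀ i, (q i).2 = g (q i).1) ∧
      ∀ B ∈ U, ∃ Z : BlockSeq, Z.span ∈ U ∧ Z.span ⊆ B ∧
        {k | ∀ i, Z.span ⊆ (q i).1 → k ∈ (q i).2} ⊆ g Z.span := by
  -- `B p k` keeps `k` out of `g (extend p B)` whenever some member of `U` does.
  have hB : ∀ (p : Finset FIN) (k : FIN), ∃ B ∈ U,
      (∃ B' ∈ U, k ∉ g (extend p B')) → k ∉ g (extend p B) := fun p k => by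
    by_cases h : ∃ B' ∈ U, k ∉ g (extend p B')
    · obtain ⟨B, hB, hk⟩ := h
      exact ⟨B, hB, fun _ => hk⟩
    · exact ⟨Set.univ, Filter.univ_mem, fun h' => absurd h' h⟩
  choose B hBU hB using hB
  let F (n : ℕ) : Finset FIN := (FIN.finite_max_le n).toFinset
  have hF : ∀ {n x}, x ∈ F n ↔ x.max ≤ n := fun {n x} => Set.Finite.mem_toFinset _
  obtain ⟨X, hX, -, hXt⟩ := hU.exists_diagonal
    (fun n => ⋂ p ∈ (F n).powerset, ⋂ k ∈ F n, B p k) fun n =>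
      (Filter.biInter_finset_mem _).2 fun p _ => (Filter.biInter_finset_mem _).2 fun k _ => hBU p k
  obtain ⟨e, he⟩ := exists_surjective_nat (Finset FIN × ℕ)
  let S (a : Finset FIN × ℕ) : Set FIN := extend a.1 (X.tail a.2).span
  refine ⟨fun i => (S (e i), g (S (e i))), fun i => rfl, fun C hC => ?_⟩
  obtain ⟨Z, hZ, hZC⟩ := hU.exists_span_subset (Filter.inter_mem hC hX)
  refine ⟨Z, hZ, fun x hx => (hZC hx).1, fun k hk => ?_⟩
  by_contra hkZ
  classical
  -- Cutting `Z` at index `k.max` puts both `k` and the elements of `p` under the bound `(Z.1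
  -- k.max).max`, so the diagonalization by `X` covers the pair `(p, k)`.
  let p : Finset FIN := (F (Z.1 k.max).max).filter (· ∈ Z.span)
  have hp : (p : Set FIN) = {x ∈ Z.span | x.max ≤ (Z.1 k.max).max} := by
    ext x
    simp [p, hF, and_comm]
  have hZp := span_eq_extend Z k.max
  rw [← hp] at hZp
  obtain ⟨I, hI⟩ := X.mem_span.1 (hZC (Z.apply_mem_span k.max)).2
  have hmax : (Z.1 k.max).max = (X.1 I.max).max := by rw [← hI, X.max_app]
  have hnot : k ∉ g (extend p (X.tail (I.max + 1)).span) := fun hmem => by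
    refine hB p k ⟨_, hU.tail_mem hZ (k.max + 1), hZp ▸ hkZ⟩ (hg (extend_mono _ ?_) hmem)
    intro x hx
    have := hXt _ hx
    rw [← hmax] at this
    exact Set.mem_iInter₂.1 (Set.mem_iInter₂.1 this p (Finset.mem_powerset.2
      (Finset.filter_subset _ _))) k (hF.2 (Z.le_max _))
  obtain ⟨i, hi⟩ := he (p, I.max + 1)
  have := hk i
  simp only [hi, S] at this
  refine hnot (this (hZp.subset.trans (extend_mono _ fun x hx => ?_)))
  exact X.mem_tail_span_of_lt (hZC (Z.tail_span_subset _ hx)).2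
    (hmax ▸ Z.lt_min_of_mem_tail_span hx)

/-- A monotone reduction `f` gives `g`, approximated by some `q`. If `W.span` misses its hull, it
misses `g W.span`, though both are in `U`. Otherwise, some `Z` below `W` has its hull inside `g
Z.span`, hence inside `ρ ⁻¹' (ρ '' W.span)`, which `W` forbids. -/
theorem not_tukeyLE_map {α β : Type*} {π : FIN → α} {ρ : FIN → β}
    (h : ∀ q, ∃ W : BlockSeq, W.span ∈ U ∧ W.Defeats π ρ q) :
    ¬ TukeyLE (UltrafilterOrder (U.map ρ)) (UltrafilterOrder (U.map π)) := by
  intro hT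
  obtain ⟨f, hf, hfU, hfC⟩ := hT.exists_monotone
  let g (B : Set FIN) : Set FIN := ρ ⁻¹' f (π '' B)
  obtain ⟨q, hq, hqU⟩ := hU.exists_approx (g := g) fun B B' hB =>
    Set.preimage_mono (hf (Set.image_mono hB))
  obtain ⟨W, hWU, hW | hW⟩ := h q
  · have : g W.span ⊆ approxHull π q W.span := fun k hk i hi => by
      rw [hq]
      exact hf hi hk
    obtain ⟨x, hx, hx'⟩ := U.nonempty_of_mem
      (Filter.inter_mem hWU (hfU _ (Filter.image_mem_map hWU)))
    exact Set.disjoint_left.1 hW hx (this hx')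
  · obtain ⟨S, hS, hSW⟩ := hfC _ (Filter.image_mem_map (m := ρ) hWU)
    obtain ⟨Z, -, hZ, hZg⟩ := hqU _ (Filter.inter_mem hWU (show π ⁻¹' S ∈ U from hS))
    refine hW Z (fun x hx => (hZ hx).1) fun k hk => ?_
    refine hSW (hf (Set.image_subset_iff.2 fun x hx => (hZ hx).2) (hZg fun i hi => ?_))
    exact hk i (Set.image_mono hi)

end IsStable

/-! ### Assembling the generic ultrafilter -/

theorem theorem6p10 (CH : Cardinal.aleph.{0} 1 = Cardinal.continuum.{0}) :
    ∃ U : Ultrafilter FIN, IsBlockBasic U ∧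
      TukeyLT (UltrafilterOrder (U.map FIN.minMax)) (UltrafilterOrder U) ∧
      IsSelective (U.map FIN.min) ∧ IsSelective (U.map FIN.max) ∧
      TukeyIncomparable (UltrafilterOrder (U.map FIN.min)) (UltrafilterOrder (U.map FIN.max)) ∧
      TukeyLT (UltrafilterOrder (U.map FIN.min)) (UltrafilterOrder (U.map FIN.minMax)) ∧
      TukeyLT (UltrafilterOrder (U.map FIN.max)) (UltrafilterOrder (U.map FIN.minMax)) ∧
      TukeyLT Unit (UltrafilterOrder (U.map FIN.min)) ∧
      TukeyLT Unit (UltrafilterOrder (U.map FIN.max)) := by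
  let D : (ℕ → Set FIN × Set FIN) × Fin 4 → Set BlockSeq := fun r =>
    ![{Y | Y.Decides fun n => (r.1 n).1}, {Y | Y.Defeats FIN.min FIN.max r.1},
      {Y | Y.Defeats FIN.max FIN.min r.1}, {Y | Y.Defeats FIN.minMax id r.1}] r.2
  have hD : ∀ r (X : BlockSeq), ∃ Y ∈ D r, Y.span ⊆ X.span := by
    rintro ⟨q, k⟩ X
    suffices ∃ Y : BlockSeq, Y.span ⊆ X.span ∧ Y ∈ D (q, k) by
      obtain ⟨Y, h, h'⟩ := this
      exact ⟨Y, h', h⟩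
    fin_cases k
    exacts [X.exists_decides _, FIN.splits_min_max.exists_defeats X q,
      FIN.splits_max_min.exists_defeats X q, FIN.splits_minMax_id.exists_defeats X q]
  have hcard : Cardinal.mk ((ℕ → Set FIN × Set FIN) × Fin 4) ≤ Cardinal.continuum := by
    have : Infinite FIN := Infinite.of_injective FIN.single fun m n h => by
      simpa using congrArg FIN.min h
    simp
  obtain ⟨U, hmin, -, hUD⟩ := BlockSeq.exists_generic_ultrafilter CH hcard hD fun A =>
    ⟨(fun _ => (A, A), 0), fun X hX => by
      rcases (hX : X.Decides fun _ => A) with h | h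
      exacts [Or.inr h.choose_spec, Or.inl h.1]⟩
  have hU : IsStable U := ⟨hmin, fun A hA => by
    obtain ⟨Y, hY, hYU⟩ := hUD (fun n => (A n, A n), 0)
    refine ⟨Y, hYU, (hY : Y.Decides A).resolve_left fun ⟨n, hn⟩ => ?_⟩
    obtain ⟨x, hx, hx'⟩ := U.nonempty_of_mem (Filter.inter_mem hYU (hA n))
    exact Set.disjoint_left.1 hn hx hx'⟩
  have hmaxmin : ¬ TukeyLE (UltrafilterOrder (U.map FIN.max)) (UltrafilterOrder (U.map FIN.min)) :=
    hU.not_tukeyLE_map fun q => (hUD (q, 1)).imp fun W h => ⟨h.2, h.1⟩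
  have hminmax : ¬ TukeyLE (UltrafilterOrder (U.map FIN.min)) (UltrafilterOrder (U.map FIN.max)) :=
    hU.not_tukeyLE_map fun q => (hUD (q, 2)).imp fun W h => ⟨h.2, h.1⟩
  have hid : ¬ TukeyLE (UltrafilterOrder (U.map id)) (UltrafilterOrder (U.map FIN.minMax)) :=
    hU.not_tukeyLE_map fun q => (hUD (q, 3)).imp fun W h => ⟨h.2, h.1⟩
  have hfst : TukeyLE (UltrafilterOrder (U.map FIN.min)) (UltrafilterOrder (U.map FIN.minMax)) :=
    tukeyLE_map Prod.fst (U.map FIN.minMax)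
  have hsnd : TukeyLE (UltrafilterOrder (U.map FIN.max)) (UltrafilterOrder (U.map FIN.minMax)) :=
    tukeyLE_map Prod.snd (U.map FIN.minMax)
  rw [Ultrafilter.map_id] at hid
  refine ⟨U, hU.isBlockBasic, ⟨tukeyLE_map _ U, hid⟩,
    hU.isSelective_map FIN.min_le_max fun X I => ⟨I.min, X.min_app I⟩,
    hU.isSelective_map (fun _ => le_rfl) fun X I => ⟨I.max, X.max_app I⟩, ⟨hminmax, hmaxmin⟩,
    ⟨hfst, fun h => hmaxmin (hsnd.trans h)⟩, ⟨hsnd, fun h => hminmax (hfst.trans h)⟩,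
    tukeyLT_unit hmin, tukeyLT_unit fun n => ?_⟩
  exact Filter.mem_map.2 (Filter.mem_of_superset (hmin n) fun x hx =>
    Set.mem_preimage.2 (show n < x.max from lt_of_lt_of_le hx x.min_le_max))
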